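/- **Setting.** A *creased paper* $(P,C)$ consists of a connected piecewise-planar surface $M$ (a 2-manifold, possibly with boundary), cut by a locally finite straight-line crease pattern $C$ into at most countably many connected open planar *panels*, and a continuous map $g:M\to\mathbb R^3$ with closed image that is a local isometry onto planar pieces on every panel; layers may touch in space, and a unit normal is chosen on each panel (coherently, if the paper is oriented). It is assumed that the paper admits an order function, as defined next. A *rigidly folded state* is a pair $(f,\lambda)$. Here $f:M\to\mathbb R^3$ is continuous, has closed image, preserves lengths of curves, and is on each panel the composition of $g$ with a rotation and a translation; Euclidean motions are excluded by requiring $f=g$ on a fixed panel $P_0$. The *order function* $\lambda$ assigns to each pair of distinct non-crease points $p,q\in M$ with $f(p)=f(q)$ a value $\lambda(p,q)=\pm1$, with $+1$ meaning that the layer of $p$ lies on the side of the layer of $q$ to which the normal at $q$ points. It must be antisymmetric, transitive, locally constant (consistent), and noncrossing: if two layers meet, at panel points or inner crease points, and have cross-sections perpendicular to a common axis, then both halves of one cross-section are on the same side of the other, where ties between coinciding halves are decided by $\lambda$. At each inner crease $c_j$ let $\rho_j\in[-\pi,\pi]$ be the signed *folding angle* by which the two adjacent panels deviate from a plane in the state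 $(f,\lambda)$, measured from the chosen orientation; for completely folded creases $\lambda$ decides between $\pi$ and $-\pi$. Write $\boldsymbol\rho=(\rho_j)_j$. The *configuration space* is the set $\{(\boldsymbol\rho,\lambda)\}_{P,C}$ of the pairs that come from rigidly folded states; the *configuration map* $F$ sends $(\boldsymbol\rho,\lambda)$ to the corresponding $(f,\lambda)$. A family $\lambda_t$ of order functions, belonging to states $(f_t,\lambda_t)$, is *continuous at* $t_0$ if for all $p,q$ in the domain of $\lambda_{t_0}$ there are neighbourhoods $U\ni p$, $V\ni q$ such that for all $t$ near $t_0$ and all $p'\in U$, $q'\in V$: $\lambda_t(p',q')=\lambda_{t_0}(p,q)$ whenever $(p',q')$ is in the domain of $\lambda_t$, and $\lambda_{t_0}(p,q)\,\langle f_t(p')-f_t(q'),\,n_{f_t}(q')\rangle\ge 0$ whenever $q'$ is a non-crease point, with $n_{f_t}(q')$ the unit normal at $q'$ in the state $f_t$. The state $(f_1,\lambda_1)$ is *rigid-foldable* to $(f_2,\lambda_2)$ if there is a family of rigidly folded states $(f_t,\lambda_t)_{t\in[0,1]}$ from the first to the second with $\lambda_t$ continuous and $f_t$ continuous in $t$ for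 the supremum metric $\sup_{p\in M}\|f_{t'}(p)-f_t(p)\|$. Two configurations are *0-connected* (lie in the same path component of the configuration space) if they are joined by a path $(\boldsymbol\rho_t,\lambda_t)_{t\in[0,1]}$ in the configuration space with every $\rho_j$ continuous in $t$, and with $\lambda_t$ continuous for the states $F(\boldsymbol\rho_t,\lambda_t)$. **Theorem.** Let $(P,C)$ be a creased paper, and let $(f_1,\lambda_1)$, $(f_2,\lambda_2)$ be rigidly folded states with configurations $(\boldsymbol\rho_1,\lambda_1)$, $(\boldsymbol\rho_2,\lambda_2)$. 1. If the paper is compact, then $(f_1,\lambda_1)$ is rigid-foldable to $(f_2,\lambda_2)$ if and only if $(\boldsymbol\rho_1,\lambda_1)$ and $(\boldsymbol\rho_2,\lambda_2)$ are 0-connected in the configuration space $\{(\boldsymbol\rho,\lambda)\}_{P,C}$. 2. For an arbitrary paper, compact or not, the same equivalence holds if in the definition of rigid-foldability $f_t$ is required to be continuous in $t$ for locally uniform convergence on $M$ instead of the supremum metric. -/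

import Mathlib

open Set Filter Topology

namespace RigidOrigami

/-- Euclidean three-space. -/
abbrev E3 : Type := EuclideanSpace ℝ (Fin 3)

/-- The kinds of points of a creased surface with panels indexed by `ι` and inner creases indexed
by `κ`: a point of a (relatively open) panel, a point of an inner crease (without its endpoints), a
point of an outer crease (a boundary edge without its endpoints), or a vertex. -/
inductive Stratum (ι κ : Type*) where
  | panel (i : ι) : Stratum ι κ
  | inner (e : κ) : Stratum ι κ
  | outer : Stratum ι κ
  | vertex : Stratum ι κ

/-- A fan at `x`: a neighbourhood of `x` in polar coordinates `(s, θ)`, `0 ≤ s ≤ radius`,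
`0 ≤ θ ≤ angle n`. It consists of `n` planar sectors; the `k`-th one, `angle k ≤ θ ≤ angle (k+1)`,
has sector angle `angle (k+1) - angle k` and interior in the panel `side k`, and is placed in space
by `g` as the planar sector at `g x` spanned from `u k` towards `v k`. The rays `θ = angle k` are
pieces of creases. If `closed` the fan closes up around `x` (an interior point of the surface),
otherwise its first and last rays are pieces of the boundary. Sector angles lie in `(0, 2π)`, except
for a single crease ending at an interior point, where the only sector angle is `2π`. -/
structure Fan {M ι κ : Type*} [TopologicalSpace M] (g : M → E3) (st : M → Stratum ι κ)
    (x : M) where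
  closed : Prop
  n : ℕ
  angle : ℕ → ℝ
  side : ℕ → ι
  u : ℕ → E3
  v : ℕ → E3
  radius : ℝ
  toFun : ℝ → ℝ → M
  n_pos : 0 < n
  radius_pos : 0 < radius
  angle_zero : angle 0 = 0
  angle_lt : ∀ k < n, angle k < angle (k + 1)
  sector_le : ∀ k < n, angle (k + 1) - angle k < 2 * Real.pi ∨
    (closed ∧ n = 1 ∧ angle (k + 1) - angle k = 2 * Real.pi)
  orthonormal : ∀ k < n, ‖u k‖ = 1 ∧ ‖v k‖ = 1 ∧ inner ℝ (u k) (v k) = 0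
  continuousOn : ContinuousOn (fun z : ℝ × ℝ => toFun z.1 z.2) (Icc 0 radius ×ˢ Icc 0 (angle n))
  center : ∀ θ ∈ Icc 0 (angle n), toFun 0 θ = x
  isometric : ∀ k < n, ∀ s ∈ Icc 0 radius, ∀ θ ∈ Icc (angle k) (angle (k + 1)),
    g (toFun s θ) = g x + s • (Real.cos (θ - angle k) • u k + Real.sin (θ - angle k) • v k)
  panel : ∀ k < n, ∀ s ∈ Ioc 0 radius, ∀ θ ∈ Ioo (angle k) (angle (k + 1)),
    st (toFun s θ) = .panel (side k)
  inj : ∀ s ∈ Ioc 0 radius, ∀ θ ∈ Icc 0 (angle n), ∀ θ' ∈ Icc 0 (angle n),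
    toFun s θ = toFun s θ' →
      θ = θ' ∨ (closed ∧ ((θ = 0 ∧ θ' = angle n) ∨ (θ = angle n ∧ θ' = 0)))
  wrap : closed → ∀ s ∈ Icc 0 radius, toFun s 0 = toFun s (angle n)
  mem_nhds : (fun z : ℝ × ℝ => toFun z.1 z.2) '' (Icc 0 radius ×ˢ Icc 0 (angle n)) ∈ 𝓝 x
  inner_ray : ∀ k, 0 < k → k < n → ∃ e, ∀ s ∈ Ioc 0 radius, st (toFun s (angle k)) = .inner e
  end_ray_closed : closed → ∃ e, ∀ s ∈ Ioc 0 radius, st (toFun s 0) = .inner e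
  end_ray_open : ¬ closed → ∀ s ∈ Ioc 0 radius,
    st (toFun s 0) = .outer ∧ st (toFun s (angle n)) = .outer

/-- A connected piecewise-planar surface `M` (with or without boundary) with a straight-line crease
pattern, mapped to space by a piecewise isometric map `g`; different layers may overlap in space, so
`g` need not be injective. `normal i` is the unit normal which orients the panel `i`; no coherence
between different panels is required, so that non-orientable surfaces (oriented panel by panel) are
included. The inner crease `e` is a straight segment (or ray, or line) in direction `dir e`, along
which the panels `left e` and `right e` meet; `leftVec e`, `rightVec e` are the unit vectors
perpendicular to `dir e` that point from the crease into these panels. -/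
structure CreaseSurface (M ι κ : Type*) [TopologicalSpace M] where
  g : M → E3
  stratum : M → Stratum ι κ
  normal : ι → E3
  dir : κ → E3
  left : κ → ι
  right : κ → ι
  leftVec : κ → E3
  rightVec : κ → E3
  t2 : T2Space M
  connected : ConnectedSpace M
  countable_panels : Countable ι
  countable_creases : Countable κ
  continuous_g : Continuous g
  isClosed_range : IsClosed (range g)
  panel_connected : ∀ i, IsConnected (stratum ⁻¹' {.panel i})
  crease_connected : ∀ e, IsConnected (stratum ⁻¹' {.inner e})
  norm_normal : ∀ i, ‖normal i‖ = 1
  /-- Every point of a panel has a neighbourhood that `g` maps homeomorphically to a planar disc. -/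
  panel_chart : ∀ x i, stratum x = .panel i → ∃ N ∈ 𝓝 x, IsCompact N ∧
    N ⊆ stratum ⁻¹' {.panel i} ∧ InjOn g N ∧
    ∃ r : ℝ, 0 < r ∧ g '' N = {z | dist z (g x) ≤ r ∧ inner ℝ (z - g x) (normal i) = 0}
  /-- Every point of an inner crease has a neighbourhood made of two half-discs. -/
  crease_chart : ∀ x e, stratum x = .inner e → ∃ F : Fan g stratum x, F.closed ∧ F.n = 2 ∧
    F.angle 1 = Real.pi ∧ F.angle 2 = 2 * Real.pi ∧
    F.side 0 = left e ∧ F.u 0 = dir e ∧ F.v 0 = leftVec e ∧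
    F.side 1 = right e ∧ F.u 1 = - dir e ∧ F.v 1 = rightVec e ∧
    ∀ s ∈ Ioc 0 F.radius, F.toFun s 0 ∈ stratum ⁻¹' {.inner e} ∧
      F.toFun s Real.pi ∈ stratum ⁻¹' {.inner e}
  /-- Every point of an outer crease has a neighbourhood which is a half-disc. -/
  outer_chart : ∀ x, stratum x = .outer → ∃ F : Fan g stratum x, ¬ F.closed ∧ F.n = 1 ∧
    F.angle 1 = Real.pi
  vertex_chart : ∀ x, stratum x = .vertex → Nonempty (Fan g stratum x)

/-- A curve that crosses the surface perpendicularly to a direction `axis`: it starts in the panel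
`j` on a straight line, passes `base`, and goes on in the panel `i` on a straight line. Here `a` and
`b` are the unit vectors pointing from `base` into the two halves. The point `base` either lies in a
panel, and `axis` is tangent to it, or on an inner crease, whose direction is `axis`. -/
structure CrossSection {M ι κ : Type*} [TopologicalSpace M] (S : CreaseSurface M ι κ) where
  base : M
  axis : E3
  i : ι
  j : ι
  a : E3
  b : E3
  radius : ℝ
  path : ℝ → M
  radius_pos : 0 < radius
  path_zero : path 0 = base
  continuousOn : ContinuousOn path (Icc (-radius) radius)
  injOn : InjOn path (Icc (-radius) radius)
  norm_axis : ‖axis‖ = 1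
  norm_a : ‖a‖ = 1
  norm_b : ‖b‖ = 1
  inner_a : inner ℝ axis a = 0
  inner_b : inner ℝ axis b = 0
  pos : ∀ y ∈ Ioc 0 radius, S.stratum (path y) = .panel i ∧ S.g (path y) = S.g base + y • a
  neg : ∀ y ∈ Ioc 0 radius, S.stratum (path (-y)) = .panel j ∧ S.g (path (-y)) = S.g base + y • b
  base_spec : ((∃ k, S.stratum base = .panel k) ∧ inner ℝ axis (S.normal i) = 0) ∨
    ∃ e, S.stratum base = .inner e ∧ (axis = S.dir e ∨ axis = - S.dir e)

/-- A map of the surface to space that preserves the lengths of curves and restricts on each panel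
`i` to a rotation `rot i` followed by a translation `trans i` (both are determined by the map). -/
structure Placement {M ι κ : Type*} [TopologicalSpace M] (S : CreaseSurface M ι κ) where
  f : M → E3
  rot : ι → E3 ≃ₗᵢ[ℝ] E3
  trans : ι → E3
  continuous_f : Continuous f
  det_rot : ∀ i, LinearMap.det ((rot i).toLinearEquiv : E3 →ₗ[ℝ] E3) = 1
  f_eq : ∀ x i, S.stratum x = .panel i → f x = rot i (S.g x) + trans i
  length_eq : ∀ γ : ℝ → M, ContinuousOn γ (Icc 0 1) →
    eVariationOn (f ∘ γ) (Icc 0 1) = eVariationOn (S.g ∘ γ) (Icc 0 1)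
  isClosed_range : IsClosed (range f)

namespace Placement

variable {M ι κ : Type*} [TopologicalSpace M] {S : CreaseSurface M ι κ}

/-- The identity placement. -/
noncomputable def refl (S : CreaseSurface M ι κ) : Placement S where
  f := S.g
  rot := fun _ => LinearIsometryEquiv.refl ℝ E3
  trans := fun _ => 0
  continuous_f := S.continuous_g
  det_rot := fun _ => LinearMap.det_id
  f_eq := fun x i _ => by simp
  length_eq := fun _ _ => rfl
  isClosed_range := S.isClosed_range

/-- The oriented unit normal of the placed surface at a non-crease point (zero elsewhere). -/
noncomputable def normal (A : Placement S) (p : M) : E3 :=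
  match S.stratum p with
  | .panel i => A.rot i (S.normal i)
  | _ => 0

/-- Two different non-crease points that are placed at the same point of space. -/
def Contact (A : Placement S) (p q : M) : Prop :=
  p ≠ q ∧ (∃ i, S.stratum p = .panel i) ∧ (∃ j, S.stratum q = .panel j) ∧ A.f p = A.f q

/-- The unit vector pointing from the layer of `q` to the layer of `p`, for points in contact:
`lam p q = 1` means that `p` lies on the side of `q` to which the normal at `q` points. -/
noncomputable def side (A : Placement S) (lam : M → M → ℝ) (p q : M) : E3 :=
  lam p q • A.normal q

open Classical in
/-- The signed folding angle, in `[-π, π]`, by which the two halves of a cross-section deviate from a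
straight line, measured from the orientation of the panel `i`. With `a`, `b` the placed unit vectors
along the two halves and `n` the placed normal of the panel `i`, the angle `ρ` satisfies
`b = - cos ρ • a - sin ρ • n`; thus `ρ > 0` is a mountain and `ρ < 0` a valley, seen from the side of
the normal. If the halves coincide (`a = b`), then the angle is `-π` when the second half lies on the
side of the normal of the first half, and `π` otherwise. -/
noncomputable def bend (A : Placement S) (lam : M → M → ℝ) (c : CrossSection S) : ℝ :=
  if A.rot c.j c.b = A.rot c.i c.a then
    if lam (c.path (-c.radius)) (c.path c.radius) = 1 then -Real.pi else Real.pi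
  else
    Complex.arg ⟨- inner ℝ (A.rot c.j c.b) (A.rot c.i c.a),
      - inner ℝ (A.rot c.j c.b) (A.rot c.i (S.normal c.i))⟩

/-- A half-layer which leaves the common point of contact in direction `w` (perpendicularly to the
axis of the cross-section `c`), along the curve `γ y`, `y > 0`, is on the top side of `c`, i.e. on
the side of the normal `n` of the first half of `c`. Going from the first half (direction `a`)
through the top side, the second half (direction `b`) is reached after the angle `π + bend`. If `w`
is different from `a` and `b`, the position of `w` decides; if `w` coincides with `a` or `b`, the
order function does; if `w = a = b`, then the top side is the inside of a completely folded valley,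
and the outside of a completely folded mountain. -/
noncomputable def OnTop (A : Placement S) (lam : M → M → ℝ) (c : CrossSection S) (w : E3)
    (γ : ℝ → M) : Prop :=
  let a := A.rot c.i c.a
  let b := A.rot c.j c.b
  let n := A.rot c.i (S.normal c.i)
  let ψ := Real.pi + A.bend lam c
  let aboveA : Prop := ∀ᶠ y in 𝓝[>] (0 : ℝ), A.side lam (γ y) (c.path y) = n
  let aboveB : Prop := ∀ᶠ y in 𝓝[>] (0 : ℝ),
    A.side lam (γ y) (c.path (-y)) = Real.sin ψ • a - Real.cos ψ • n
  (∃ η, 0 < η ∧ η < ψ ∧ w = Real.cos η • a + Real.sin η • n) ∨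
  (w = a ∧ w ≠ b ∧ aboveA) ∨
  (w = b ∧ w ≠ a ∧ aboveB) ∨
  (w = a ∧ w = b ∧ ((ψ = 0 ∧ aboveA ∧ aboveB) ∨ (ψ ≠ 0 ∧ (aboveA ∨ aboveB))))

/-- `lam` is an order function of the placed surface: it is defined (with values `1`, `-1`) on the
pairs of non-crease points in contact, and satisfies the antisymmetry, transitivity, consistency and
noncrossing conditions. Outside its domain it is given the value `0`. -/
structure IsOrderFunction (A : Placement S) (lam : M → M → ℝ) : Prop where
  values : ∀ p q, A.Contact p q → lam p q = 1 ∨ lam p q = -1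
  off_domain : ∀ p q, ¬ A.Contact p q → lam p q = 0
  /-- If `p` is above `q`, then `q` is below `p`. -/
  antisymmetry : ∀ p q, A.Contact p q → A.side lam q p = - A.side lam p q
  /-- If `p` is above `q`, and `q` is above `r`, then `p` is above `r`. -/
  transitivity : ∀ p q r, A.Contact p q → A.Contact q r → A.Contact p r →
    A.side lam p q = A.side lam q r → A.side lam p r = A.side lam p q
  /-- The order is locally constant on pairs of points in contact. -/
  consistency : ∀ p q, A.Contact p q → ∃ U ∈ 𝓝 p, ∃ V ∈ 𝓝 q, ∀ p' ∈ U, ∀ q' ∈ V,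
    A.Contact p' q' → lam p' q' = lam p q
  /-- Where two layers meet (at panel points or inner crease points), and have cross-sections with
  the same axis, both halves of one of them are on the same side of the other. -/
  noncrossing : ∀ c c' : CrossSection S, c.base ≠ c'.base → A.f c.base = A.f c'.base →
    (A.rot c.i c.axis = A.rot c'.i c'.axis ∨ A.rot c.i c.axis = - A.rot c'.i c'.axis) →
    (A.OnTop lam c' (A.rot c.i c.a) (fun y => c.path y) ↔
      A.OnTop lam c' (A.rot c.j c.b) (fun y => c.path (-y)))

end Placement

/-- A creased paper with piecewise-planar paper and straight-line crease pattern: a creased surface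
that has an order function. For each inner crease `e` a cross-section `ref e` from the right to the
left panel is chosen, on which the folding angle is measured. -/
structure CreasedPaper (M ι κ : Type*) [TopologicalSpace M] extends CreaseSurface M ι κ where
  ref : κ → CrossSection toCreaseSurface
  ref_base : ∀ e, stratum (ref e).base = .inner e
  ref_axis : ∀ e, (ref e).axis = dir e
  ref_left : ∀ e, (ref e).i = left e ∧ (ref e).a = leftVec e
  ref_right : ∀ e, (ref e).j = right e ∧ (ref e).b = rightVec e
  exists_order : ∃ lam, (Placement.refl toCreaseSurface).IsOrderFunction lam

/-- A rigidly folded state `(f, λ)`; Euclidean motions are excluded by fixing the panel `i₀`. -/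
structure RigidlyFoldedState {M ι κ : Type*} [TopologicalSpace M] (P : CreasedPaper M ι κ)
    (i₀ : ι) extends Placement P.toCreaseSurface where
  order : M → M → ℝ
  isOrder : toPlacement.IsOrderFunction order
  rot_base : rot i₀ = LinearIsometryEquiv.refl ℝ E3
  trans_base : trans i₀ = 0

variable {M ι κ : Type*} [TopologicalSpace M] {P : CreasedPaper M ι κ} {i₀ : ι}

/-- The folding angles of a rigidly folded state. -/
noncomputable def RigidlyFoldedState.foldingAngle (s : RigidlyFoldedState P i₀) (e : κ) : ℝ :=
  s.toPlacement.bend s.order (P.ref e)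

/-- Convergence of the order functions `λ_x → λ` of rigidly folded states: if `p` and `q` are in
contact in the limit state, then in all states sufficiently close to the limit, layers near `p` and
`q` which are in contact have the order of `p` and `q`, and the layer near `p` does not lie strictly
on the wrong side of the layer near `q`. -/
def OrderTendsto {α : Type*} (l : Filter α) (S : α → RigidlyFoldedState P i₀)
    (s : RigidlyFoldedState P i₀) : Prop :=
  ∀ p q, s.Contact p q → ∃ U ∈ 𝓝 p, ∃ V ∈ 𝓝 q, ∀ᶠ x in l, ∀ p' ∈ U, ∀ q' ∈ V,
    ((S x).Contact p' q' → (S x).order p' q' = s.order p q) ∧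
    0 ≤ s.order p q * inner ℝ ((S x).f p' - (S x).f q') ((S x).normal q')

/-- `s₁` is rigid-foldable to `s₂`: there is a rigid folding motion between them, continuous for the
supremum metric on the maps `f` and for the convergence of order functions. -/
def RigidFoldable (s₁ s₂ : RigidlyFoldedState P i₀) : Prop :=
  ∃ γ : unitInterval → RigidlyFoldedState P i₀, γ 0 = s₁ ∧ γ 1 = s₂ ∧
    ∀ t, TendstoUniformly (fun t' => (γ t').f) (γ t).f (𝓝 t) ∧ OrderTendsto (𝓝 t) γ (γ t)

/-- The same with locally uniform convergence of the maps `f` (for papers that are not bounded). -/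
def LocallyRigidFoldable (s₁ s₂ : RigidlyFoldedState P i₀) : Prop :=
  ∃ γ : unitInterval → RigidlyFoldedState P i₀, γ 0 = s₁ ∧ γ 1 = s₂ ∧
    ∀ t, TendstoLocallyUniformly (fun t' => (γ t').f) (γ t).f (𝓝 t) ∧ OrderTendsto (𝓝 t) γ (γ t)

/-- The configuration space: the pairs `(ρ, λ)` of the folding angles and the order function of the
rigidly folded states. -/
def ConfigurationSpace (P : CreasedPaper M ι κ) (i₀ : ι) : Set ((κ → ℝ) × (M → M → ℝ)) :=
  range fun s : RigidlyFoldedState P i₀ => (s.foldingAngle, s.order)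

/-- The configuration `(ρ, λ)` of a rigidly folded state `(f, λ)`. -/
noncomputable def RigidlyFoldedState.configuration (s : RigidlyFoldedState P i₀) :
    ConfigurationSpace P i₀ :=
  ⟨(s.foldingAngle, s.order), mem_range_self s⟩

/-- The configuration map `F`, `(ρ, λ) ↦ (f, λ)`: the rigidly folded state with the given folding
angles and order function. -/
noncomputable def configurationMap (c : ConfigurationSpace P i₀) : RigidlyFoldedState P i₀ :=
  c.2.choose

/-- `c₁` and `c₂` are joined by a path `(ρ_t, λ_t)` in the configuration space, where `ρ_t` is
continuous, and `λ_t` is continuous for the convergence of order functions. -/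
def ZeroConnected (c₁ c₂ : ConfigurationSpace P i₀) : Prop :=
  ∃ L : unitInterval → ConfigurationSpace P i₀, L 0 = c₁ ∧ L 1 = c₂ ∧
    ∀ t, Tendsto (fun t' => (L t').1.1) (𝓝 t) (𝓝 (L t).1.1) ∧
      OrderTendsto (𝓝 t) (fun t' => configurationMap (L t')) (configurationMap (L t))

end RigidOrigami

/-! The configuration map is a bijection that matches the two kinds of paths. Order functions and
their convergence are the same on both sides, so what remains is to compare convergence of the maps
`f` with convergence of the folding angles.

From angles to maps: write an angle `ρ` as the unit complex number `exp (iρ)`, the `foldingPhase`.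
The phase at a crease and the motion of one adjacent panel determine the motion of the other,
continuously. The panel `i₀` is fixed and the surface is connected (`linked_all`), so all panels
converge (`CreasedPaper.tendsto_of_tendsto_foldingPhase`) and `f` converges pointwise. Near a point
all placements preserve the distances to it, an equicontinuity that makes the convergence locally
uniform. Applied to a constant family, the same argument shows that angles and order determine the
state.

From maps to angles: pointwise convergence of `f` gives convergence of the rotations, hence of the
phases. The angle is the argument of the phase, which jumps only at `-1`, for completely folded
creases. There the order convergence forces the imaginary part to one side, so that `π` and `-π`
cannot be confused (`tendsto_foldingAngle`). On a compact surface, locally uniform and uniform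
convergence coincide. -/

namespace RigidOrigami

/-! ### Cross products and convergence of rotations. -/

section Cross

/-- The cross product of Euclidean three-space. -/
def cross (x y : E3) : E3 :=
  !₂[x 1 * y 2 - x 2 * y 1, x 2 * y 0 - x 0 * y 2, x 0 * y 1 - x 1 * y 0]

lemma inner_eq_sum_coords (x y : E3) : inner ℝ x y = x 0 * y 0 + x 1 * y 1 + x 2 * y 2 := by
  simp [PiLp.inner_apply, Fin.sum_univ_three, mul_comm]

lemma inner_cross_eq_det (x y z : E3) :
    inner ℝ (cross x y) z = (EuclideanSpace.basisFun (Fin 3) ℝ).toBasis.det ![x, y, z] := by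
  rw [inner_eq_sum_coords, Module.Basis.det_apply, Matrix.det_fin_three]
  simp [cross, Module.Basis.toMatrix_apply]
  ring

/-- Pairing with `R z` turns both sides into determinants of triples, which a map of determinant one
preserves. -/
lemma map_cross (R : E3 ≃ₗᵢ[ℝ] E3)
    (hR : LinearMap.det (R.toLinearEquiv : E3 →ₗ[ℝ] E3) = 1) (x y : E3) :
    R (cross x y) = cross (R x) (R y) := by
  refine ext_inner_right ℝ fun z => ?_
  obtain ⟨z, rfl⟩ := R.surjective z
  rw [R.inner_map_map, inner_cross_eq_det, inner_cross_eq_det]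
  have h := Module.Basis.det_comp (EuclideanSpace.basisFun (Fin 3) ℝ).toBasis
    (R.toLinearEquiv : E3 →ₗ[ℝ] E3) ![x, y, z]
  rw [hR, one_mul] at h
  rw [← h]
  congr 1
  ext i
  fin_cases i <;> rfl

lemma cross_cross_left (x y z : E3) :
    cross (cross x y) z = inner ℝ x z • y - inner ℝ y z • x := by
  ext i
  fin_cases i <;> simp [cross, inner_eq_sum_coords] <;> ring

lemma cross_cross_right (x y z : E3) :
    cross x (cross y z) = inner ℝ x z • y - inner ℝ x y • z := by
  ext i
  fin_cases i <;> simp [cross, inner_eq_sum_coords] <;> ring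

lemma cross_add_smul (x y z : E3) (r s : ℝ) :
    cross x (r • y + s • z) = r • cross x y + s • cross x z := by
  ext i
  fin_cases i <;> simp [cross] <;> ring

lemma inner_cross_self_left (x y : E3) : inner ℝ x (cross x y) = 0 := by
  simp [cross, inner_eq_sum_coords]; ring

lemma inner_cross_cross (x y z w : E3) : inner ℝ (cross x y) (cross z w) =
    inner ℝ x z * inner ℝ y w - inner ℝ x w * inner ℝ y z := by
  simp [cross, inner_eq_sum_coords]; ring

lemma continuous_cross : Continuous fun p : E3 × E3 => cross p.1 p.2 := by
  unfold cross
  refine (PiLp.continuous_toLp 2 _).comp (continuous_pi fun i => ?_)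
  fin_cases i <;> simp <;> fun_prop

/-- Expansion of a vector in the frame of two orthonormal vectors and their cross product. -/
lemma eq_frame_expansion {x y : E3} (hx : ‖x‖ = 1) (hy : ‖y‖ = 1) (hxy : inner ℝ x y = 0)
    (z : E3) :
    z = inner ℝ x z • x + inner ℝ y z • y + inner ℝ (cross x y) z • cross x y := by
  have hxx : inner ℝ x x = 1 := by rw [real_inner_self_eq_norm_sq, hx]; norm_num
  have hyy : inner ℝ y y = 1 := by rw [real_inner_self_eq_norm_sq, hy]; norm_num
  have hyx : inner ℝ y x = 0 := by rw [real_inner_comm, hxy]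
  -- With `w = x × y`, compute `w × (w × z)` in two ways: as a double product with the unit vector
  -- `w`, and by expanding `w × z` first.
  have h1 := cross_cross_right (cross x y) (cross x y) z
  rw [inner_cross_cross, hxx, hyy, hxy, hyx, cross_cross_left x y z, sub_eq_add_neg, ← neg_smul,
    cross_add_smul, cross_cross_left, cross_cross_left, hxx, hyy, hxy, hyx] at h1
  simp only [zero_smul, one_smul, zero_sub, sub_zero, mul_one, smul_neg, neg_smul] at h1
  rw [eq_sub_iff_add_eq] at h1
  rw [← h1]
  abel_nf
  simp

lemma exists_unit_orthogonal (n : E3) : ∃ u : E3, ‖u‖ = 1 ∧ inner ℝ n u = 0 := by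
  have h : (Submodule.span ℝ {n})ᗮ ≠ ⊥ := by
    intro h
    rw [Submodule.orthogonal_eq_bot_iff] at h
    have h1 : Module.finrank ℝ (Submodule.span ℝ {n}) ≤ 1 := by
      simpa using finrank_span_le_card (R := ℝ) ({n} : Set E3)
    rw [h, finrank_top, finrank_euclideanSpace_fin] at h1
    omega
  obtain ⟨v, hv, hv0⟩ := Submodule.exists_mem_ne_zero_of_ne_bot h
  refine ⟨‖v‖⁻¹ • v, ?_, ?_⟩
  · rw [norm_smul, norm_inv, norm_norm, inv_mul_cancel₀ (norm_ne_zero_iff.2 hv0)]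
  · rw [inner_smul_right, Submodule.mem_orthogonal_singleton_iff_inner_right.1 hv, mul_zero]

variable {α : Type*} {l : Filter α} {R : α → E3 ≃ₗᵢ[ℝ] E3} {R' : E3 ≃ₗᵢ[ℝ] E3}

/-- Rotations which converge on two orthonormal vectors converge. -/
lemma tendsto_rotation_of_orthonormal
    (hR : ∀ t, LinearMap.det ((R t).toLinearEquiv : E3 →ₗ[ℝ] E3) = 1)
    (hR' : LinearMap.det (R'.toLinearEquiv : E3 →ₗ[ℝ] E3) = 1)
    {x y : E3} (hx : ‖x‖ = 1) (hy : ‖y‖ = 1) (hxy : inner ℝ x y = 0)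
    (hRx : Tendsto (fun t => R t x) l (𝓝 (R' x))) (hRy : Tendsto (fun t => R t y) l (𝓝 (R' y)))
    (z : E3) : Tendsto (fun t => R t z) l (𝓝 (R' z)) := by
  have h : ∀ T : E3 ≃ₗᵢ[ℝ] E3, LinearMap.det (T.toLinearEquiv : E3 →ₗ[ℝ] E3) = 1 →
      T z = inner ℝ x z • T x + inner ℝ y z • T y + inner ℝ (cross x y) z • cross (T x) (T y) := by
    intro T hT
    conv_lhs => rw [eq_frame_expansion hx hy hxy z]
    simp only [map_add, map_smul, map_cross T hT]
  rw [h R' hR']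
  simp only [fun t => h (R t) (hR t)]
  exact ((hRx.const_smul _).add (hRy.const_smul _)).add
    (((continuous_cross.tendsto (R' x, R' y)).comp (hRx.prodMk_nhds hRy)).const_smul _)

/-- Rotations which converge on a plane converge. -/
lemma tendsto_rotation_of_plane
    (hR : ∀ t, LinearMap.det ((R t).toLinearEquiv : E3 →ₗ[ℝ] E3) = 1)
    (hR' : LinearMap.det (R'.toLinearEquiv : E3 →ₗ[ℝ] E3) = 1) {n : E3} (hn : ‖n‖ = 1)
    (h : ∀ v, inner ℝ n v = 0 → Tendsto (fun t => R t v) l (𝓝 (R' v)))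
    (z : E3) : Tendsto (fun t => R t z) l (𝓝 (R' z)) := by
  obtain ⟨u, hu, hnu⟩ := exists_unit_orthogonal n
  have hnn : inner ℝ n n = 1 := by rw [real_inner_self_eq_norm_sq, hn]; norm_num
  have huu : inner ℝ u u = 1 := by rw [real_inner_self_eq_norm_sq, hu]; norm_num
  have hw : inner ℝ (cross n u) (cross n u) = 1 := by
    rw [inner_cross_cross, hnn, huu, hnu]; norm_num
  have hw1 : ‖cross n u‖ = 1 := by
    rw [real_inner_self_eq_norm_sq] at hw
    exact (pow_eq_one_iff_of_nonneg (norm_nonneg _) two_ne_zero).1 hw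
  have huw : inner ℝ u (cross n u) = 0 := by
    simp [cross, inner_eq_sum_coords]; ring
  -- `u` and `n × u` form an orthonormal basis of the plane.
  exact tendsto_rotation_of_orthonormal hR hR' hu hw1 huw (h u hnu)
    (h _ (inner_cross_self_left n u)) z

end Cross

/-! ### Fans, closed panels and adjacency across creases. -/

section Panels

variable {M ι κ : Type*} [TopologicalSpace M]

lemma Fan.exists_sector {g : M → E3} {st : M → Stratum ι κ} {x : M} (F : Fan g st x) {θ : ℝ}
    (hθ : θ ∈ Icc 0 (F.angle F.n)) :
    ∃ k < F.n, θ ∈ Icc (F.angle k) (F.angle (k + 1)) := by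
  have key : ∀ m, 0 < m → θ ≤ F.angle m → ∃ k < m, θ ∈ Icc (F.angle k) (F.angle (k + 1)) := by
    intro m
    induction m with
    | zero => intro h; omega
    | succ m ih =>
      intro _ h
      by_cases hm : F.angle m ≤ θ
      · exact ⟨m, Nat.lt_succ_self m, hm, h⟩
      · rcases Nat.eq_zero_or_pos m with rfl | hpos
        · exact absurd (F.angle_zero ▸ hθ.1) hm
        · obtain ⟨k, hk, hk'⟩ := ih hpos (not_le.1 hm).le
          exact ⟨k, hk.trans (Nat.lt_succ_self m), hk'⟩
  exact key F.n F.n_pos hθ.2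

lemma Fan.angle_mono {g : M → E3} {st : M → Stratum ι κ} {x : M} (F : Fan g st x) {j k : ℕ}
    (hjk : j ≤ k) (hk : k ≤ F.n) : F.angle j ≤ F.angle k := by
  induction k, hjk using Nat.le_induction with
  | base => exact le_rfl
  | succ k _ ih => exact (ih (by omega)).trans (F.angle_lt k (by omega)).le

lemma Fan.sector_subset {g : M → E3} {st : M → Stratum ι κ} {x : M} (F : Fan g st x) {k : ℕ}
    (hk : k < F.n) : Icc (F.angle k) (F.angle (k + 1)) ⊆ Icc 0 (F.angle F.n) := by
  refine Icc_subset_Icc ?_ (F.angle_mono (by omega) le_rfl)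
  rw [← F.angle_zero]
  exact F.angle_mono (Nat.zero_le k) hk.le

variable (S : CreaseSurface M ι κ)

/-- The set of points of a panel. -/
def CreaseSurface.panelSet (i : ι) : Set M := S.stratum ⁻¹' {.panel i}

variable {S}

lemma CreaseSurface.mem_panelSet {i : ι} {x : M} : x ∈ S.panelSet i ↔ S.stratum x = .panel i :=
  Iff.rfl

lemma CreaseSurface.isOpen_panelSet (i : ι) : IsOpen (S.panelSet i) := by
  rw [isOpen_iff_mem_nhds]
  intro x hx
  obtain ⟨N, hN, -, hsub, -⟩ := S.panel_chart x i hx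
  exact mem_of_superset hN hsub

lemma CreaseSurface.eq_of_mem_closure_panelSet {i j : ι} {x : M} (hx : x ∈ closure (S.panelSet i))
    (hj : S.stratum x = .panel j) : i = j := by
  obtain ⟨y, hyj, hyi⟩ := mem_closure_iff.1 hx _ (isOpen_panelSet j) hj
  have := (mem_panelSet.1 hyi).symm.trans (mem_panelSet.1 hyj)
  simpa using this

/-- The closed polar rectangle is the closure of a part that the fan maps into the panel. -/
lemma Fan.mem_closure_panelSet {x : M} (F : Fan S.g S.stratum x) {k : ℕ} (hk : k < F.n) {s θ : ℝ}
    (hs : s ∈ Icc 0 F.radius) (hθ : θ ∈ Icc (F.angle k) (F.angle (k + 1))) :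
    F.toFun s θ ∈ closure (S.panelSet (F.side k)) := by
  have hcl : closure (Ioc 0 F.radius ×ˢ Ioo (F.angle k) (F.angle (k + 1))) =
      Icc 0 F.radius ×ˢ Icc (F.angle k) (F.angle (k + 1)) := by
    rw [closure_prod_eq, closure_Ioc F.radius_pos.ne, closure_Ioo (F.angle_lt k hk).ne]
  have hc : ContinuousOn (fun z : ℝ × ℝ => F.toFun z.1 z.2)
      (closure (Ioc 0 F.radius ×ˢ Ioo (F.angle k) (F.angle (k + 1)))) := by
    rw [hcl]
    exact F.continuousOn.mono (prod_mono le_rfl (F.sector_subset hk))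
  have h := hc.image_closure (mem_image_of_mem _ (show ((s, θ) : ℝ × ℝ) ∈ _ from hcl ▸ ⟨hs, hθ⟩))
  refine closure_mono ?_ h
  rintro _ ⟨⟨s', θ'⟩, ⟨hs', hθ'⟩, rfl⟩
  exact F.panel k hk s' hs' θ' hθ'

lemma Fan.center_mem_closure_panelSet {x : M} (F : Fan S.g S.stratum x) {k : ℕ} (hk : k < F.n) :
    x ∈ closure (S.panelSet (F.side k)) := by
  have hθ : F.angle k ∈ Icc (F.angle k) (F.angle (k + 1)) := left_mem_Icc.2 (F.angle_lt k hk).le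
  have h := F.mem_closure_panelSet hk (left_mem_Icc.2 F.radius_pos.le) hθ
  rwa [F.center _ (F.sector_subset hk hθ)] at h

/-- The points near `x` lie in the closed panels which meet at `x`. -/
lemma Fan.nhds_subset {x : M} (F : Fan S.g S.stratum x) :
    ∃ N ∈ 𝓝 x, ∀ y ∈ N, ∃ k < F.n, y ∈ closure (S.panelSet (F.side k)) := by
  refine ⟨_, F.mem_nhds, ?_⟩
  rintro _ ⟨⟨s, θ⟩, ⟨hs, hθ⟩, rfl⟩
  obtain ⟨k, hk, hk'⟩ := F.exists_sector hθ
  exact ⟨k, hk, F.mem_closure_panelSet hk hs hk'⟩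

lemma Fan.exists_side_eq {x : M} (F : Fan S.g S.stratum x) {i : ι}
    (hi : x ∈ closure (S.panelSet i)) : ∃ k < F.n, i = F.side k := by
  obtain ⟨N, hN, h⟩ := F.nhds_subset
  obtain ⟨y, hyN, hyi⟩ := mem_closure_iff_nhds.1 hi N hN
  obtain ⟨k, hk, hyk⟩ := h y hyN
  exact ⟨k, hk, (CreaseSurface.eq_of_mem_closure_panelSet hyk hyi).symm⟩

lemma CreaseSurface.eq_left_or_right {x : M} {e : κ} {i : ι} (hx : S.stratum x = .inner e)
    (hi : x ∈ closure (S.panelSet i)) : i = S.left e ∨ i = S.right e := by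
  obtain ⟨F, -, hn, -, -, h0, -, -, h1, -⟩ := S.crease_chart x e hx
  obtain ⟨k, hk, rfl⟩ := F.exists_side_eq hi
  rw [hn] at hk
  interval_cases k
  · exact Or.inl h0
  · exact Or.inr h1

/-- Panels which cannot be separated by a property that is preserved by crossing creases. -/
def CreaseSurface.Linked (S : CreaseSurface M ι κ) (i j : ι) : Prop :=
  ∀ Q : ι → Prop, (∀ e, Q (S.left e) ↔ Q (S.right e)) → (Q i ↔ Q j)

lemma CreaseSurface.Linked.symm {i j : ι} (h : S.Linked i j) : S.Linked j i :=
  fun Q hQ => (h Q hQ).symm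

lemma CreaseSurface.Linked.trans {i j k : ι} (h : S.Linked i j) (h' : S.Linked j k) :
    S.Linked i k :=
  fun Q hQ => (h Q hQ).trans (h' Q hQ)

/-- The two sectors share a ray in an inner crease `e`, so each of their panels is `left e` or
`right e`, possibly the same one. -/
lemma Fan.linked_succ {x : M} (F : Fan S.g S.stratum x) {k : ℕ} (hk : k + 1 < F.n) :
    S.Linked (F.side k) (F.side (k + 1)) := by
  obtain ⟨e, he⟩ := F.inner_ray (k + 1) (Nat.succ_pos k) hk
  have he' := he _ (right_mem_Ioc.2 F.radius_pos)
  have hr : F.radius ∈ Icc 0 F.radius := right_mem_Icc.2 F.radius_pos.le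
  have h1 := CreaseSurface.eq_left_or_right he' (F.mem_closure_panelSet (k := k) (by omega) hr
    (right_mem_Icc.2 (F.angle_lt k (by omega)).le))
  have h2 := CreaseSurface.eq_left_or_right he' (F.mem_closure_panelSet hk hr
    (left_mem_Icc.2 (F.angle_lt (k + 1) hk).le))
  intro Q hQ
  rcases h1 with h1 | h1 <;> rcases h2 with h2 | h2 <;> rw [h1, h2]
  · exact hQ e
  · exact (hQ e).symm

lemma Fan.linked {x : M} (F : Fan S.g S.stratum x) {k : ℕ} (hk : k < F.n) :
    S.Linked (F.side 0) (F.side k) := by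
  induction k with
  | zero => exact fun _ _ => Iff.rfl
  | succ k ih => exact (ih (by omega)).trans (F.linked_succ hk)

/-- The points near `x` lie in the closed panels which contain `x`, and these panels are linked. -/
lemma CreaseSurface.exists_nhds (x : M) :
    (∃ N ∈ 𝓝 x, ∀ y ∈ N, ∃ i, x ∈ closure (S.panelSet i) ∧ y ∈ closure (S.panelSet i)) ∧
      ∀ i j, x ∈ closure (S.panelSet i) → x ∈ closure (S.panelSet j) → S.Linked i j := by
  have hfan : ∀ F : Fan S.g S.stratum x,
      (∃ N ∈ 𝓝 x, ∀ y ∈ N, ∃ i, x ∈ closure (S.panelSet i) ∧ y ∈ closure (S.panelSet i)) ∧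
        ∀ i j, x ∈ closure (S.panelSet i) → x ∈ closure (S.panelSet j) → S.Linked i j := by
    intro F
    refine ⟨?_, fun i j hi hj => ?_⟩
    · obtain ⟨N, hN, h⟩ := F.nhds_subset
      refine ⟨N, hN, fun y hy => ?_⟩
      obtain ⟨k, hk, hyk⟩ := h y hy
      exact ⟨F.side k, F.center_mem_closure_panelSet hk, hyk⟩
    · obtain ⟨k, hk, rfl⟩ := F.exists_side_eq hi
      obtain ⟨m, hm, rfl⟩ := F.exists_side_eq hj
      exact (F.linked hk).symm.trans (F.linked hm)
  rcases hx : S.stratum x with i | e | _ | _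
  · refine ⟨⟨S.panelSet i, (isOpen_panelSet i).mem_nhds hx, fun y hy =>
      ⟨i, subset_closure hx, subset_closure hy⟩⟩, fun j k hj hk => ?_⟩
    rw [eq_of_mem_closure_panelSet hj hx, eq_of_mem_closure_panelSet hk hx]
    exact fun _ _ => Iff.rfl
  · exact hfan (S.crease_chart x e hx).choose
  · exact hfan (S.outer_chart x hx).choose
  · exact hfan (S.vertex_chart x hx).some

lemma CreaseSurface.linked_all (i j : ι) : S.Linked i j := by
  have := S.connected
  have hex : ∀ x : M, ∃ i, x ∈ closure (S.panelSet i) := fun x => by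
    obtain ⟨⟨N, hN, h⟩, -⟩ := S.exists_nhds x
    obtain ⟨i, hi, -⟩ := h x (mem_of_mem_nhds hN)
    exact ⟨i, hi⟩
  let r : M → M → Prop := fun x y => ∀ i j, x ∈ closure (S.panelSet i) →
    y ∈ closure (S.panelSet j) → S.Linked i j
  have hsymm : Std.Symm r := ⟨fun x y h i j hi hj => (h j i hj hi).symm⟩
  have htrans : IsTrans M r := ⟨fun x y z hxy hyz i k hi hk => by
    obtain ⟨j, hj⟩ := hex y
    exact (hxy i j hi hj).trans (hyz j k hj hk)⟩
  -- On a connected space, a symmetric and transitive relation that holds between each point and all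
  -- nearby points holds everywhere; no chain of panels is needed.
  have key : ∀ x y : M, r x y := by
    refine PreconnectedSpace.induction₂ r (fun x => ?_) htrans
    obtain ⟨⟨N, hN, h⟩, hl⟩ := S.exists_nhds x
    filter_upwards [eventually_mem_nhds_iff.2 hN] with y hy i j hi hj
    -- A closed panel through `y` has panel points in `N`, hence also contains `x`.
    obtain ⟨z, hzN, hzj⟩ := mem_closure_iff_nhds.1 hj N hy
    obtain ⟨k, hxk, hzk⟩ := h z hzN
    rw [← eq_of_mem_closure_panelSet hzk hzj]
    exact hl i k hi hxk
  obtain ⟨x, hx⟩ := (S.panel_connected i).nonempty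
  obtain ⟨y, hy⟩ := (S.panel_connected j).nonempty
  exact key x y i j (subset_closure hx) (subset_closure hy)

/-- Straight lines in a panel are perpendicular to its normal. -/
lemma CreaseSurface.inner_normal_eq_zero {i : ι} {w : E3} {y₀ : ℝ} {δ : ℝ → M}
    (hδ : ContinuousAt δ y₀) (h : ∀ᶠ y in 𝓝 y₀, S.stratum (δ y) = .panel i)
    (hg : ∀ᶠ y in 𝓝 y₀, S.g (δ y) = S.g (δ y₀) + (y - y₀) • w) :
    inner ℝ w (S.normal i) = 0 := by
  obtain ⟨N, hN, -, -, -, r, -, hr⟩ := S.panel_chart (δ y₀) i h.self_of_nhds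
  have hev : ∀ᶠ y in 𝓝[≠] y₀, y ≠ y₀ ∧ δ y ∈ N ∧ S.g (δ y) = S.g (δ y₀) + (y - y₀) • w :=
    (eventually_mem_nhdsWithin).and
      ((hδ.eventually hN |>.filter_mono nhdsWithin_le_nhds).and
        (hg.filter_mono nhdsWithin_le_nhds))
  obtain ⟨y, hy, hyN, hyg⟩ := hev.exists
  have hm : S.g (δ y) ∈ S.g '' N := mem_image_of_mem _ hyN
  rw [hr] at hm
  have h2 := hm.2
  rw [hyg, add_sub_cancel_left, inner_smul_left] at h2
  simpa [sub_eq_zero, hy] using h2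

lemma CrossSection.inner_a_normal (c : CrossSection S) : inner ℝ c.a (S.normal c.i) = 0 := by
  have hr := c.radius_pos
  -- The midpoint of the half is used because the path is straight and inside the panel on both
  -- sides of it.
  have hmem : Ioo 0 c.radius ∈ 𝓝 (c.radius / 2) := Ioo_mem_nhds (by linarith) (by linarith)
  refine CreaseSurface.inner_normal_eq_zero (y₀ := c.radius / 2) (δ := c.path) ?_ ?_ ?_
  · exact c.continuousOn.continuousAt (Icc_mem_nhds (by linarith) (by linarith))
  · filter_upwards [hmem] with y hy using (c.pos y ⟨hy.1, hy.2.le⟩).1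
  · filter_upwards [hmem] with y hy
    rw [(c.pos y ⟨hy.1, hy.2.le⟩).2, (c.pos (c.radius / 2) ⟨by linarith, by linarith⟩).2]
    module

lemma Fan.inner_ray_normal {x : M} (F : Fan S.g S.stratum x) {k : ℕ} (hk : k < F.n) {θ : ℝ}
    (hθ : θ ∈ Ioo (F.angle k) (F.angle (k + 1))) :
    inner ℝ (Real.cos (θ - F.angle k) • F.u k + Real.sin (θ - F.angle k) • F.v k)
      (S.normal (F.side k)) = 0 := by
  have hr := F.radius_pos
  have hmem : Ioo 0 F.radius ∈ 𝓝 (F.radius / 2) := Ioo_mem_nhds (by linarith) (by linarith)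
  have hθ' := F.sector_subset hk (Ioo_subset_Icc_self hθ)
  refine CreaseSurface.inner_normal_eq_zero (y₀ := F.radius / 2) (δ := fun s => F.toFun s θ)
    ?_ ?_ ?_
  · have h : ContinuousOn (fun s => F.toFun s θ) (Icc 0 F.radius) :=
      F.continuousOn.comp (f := fun s : ℝ => (s, θ)) (by fun_prop) fun s hs => ⟨hs, hθ'⟩
    exact h.continuousAt (Icc_mem_nhds (by linarith) (by linarith))
  · filter_upwards [hmem] with s hs using F.panel k hk s ⟨hs.1, hs.2.le⟩ θ hθ
  · filter_upwards [hmem] with s hs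
    rw [F.isometric k hk s ⟨hs.1.le, hs.2.le⟩ θ (Ioo_subset_Icc_self hθ),
      F.isometric k hk (F.radius / 2) ⟨by linarith, by linarith⟩ θ (Ioo_subset_Icc_self hθ)]
    module

end Panels

/-- `d` is a nonzero multiple of `a × n`, so `b ⊥ d` has no third coordinate. -/
lemma eq_planar_expansion {d a n b : E3} (hd : ‖d‖ = 1) (ha : ‖a‖ = 1) (hn : ‖n‖ = 1)
    (hda : inner ℝ d a = 0) (hdn : inner ℝ d n = 0) (han : inner ℝ a n = 0)
    (hdb : inner ℝ d b = 0) : b = inner ℝ b a • a + inner ℝ b n • n := by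
  have h1 := eq_frame_expansion ha hn han d
  rw [real_inner_comm, hda, real_inner_comm, hdn, zero_smul, zero_smul, zero_add, zero_add] at h1
  have hne : inner ℝ (cross a n) d ≠ 0 := by
    intro h0
    rw [h0, zero_smul] at h1
    simp [h1] at hd
  have h2 : inner ℝ (cross a n) b = 0 := by
    rw [h1, inner_smul_left] at hdb
    exact (mul_eq_zero.1 hdb).resolve_left hne
  have h3 := eq_frame_expansion ha hn han b
  rwa [h2, zero_smul, add_zero, real_inner_comm, real_inner_comm b n] at h3

/-! ### Placements: pointwise convergence and its consequences. -/

namespace Placement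

variable {M ι κ : Type*} [TopologicalSpace M] {S : CreaseSurface M ι κ}

lemma f_eq_of_mem_closure (A : Placement S) {i : ι} {x : M} (hx : x ∈ closure (S.panelSet i)) :
    A.f x = A.rot i (S.g x) + A.trans i := by
  have hcl : IsClosed {y | A.f y = A.rot i (S.g y) + A.trans i} :=
    isClosed_eq A.continuous_f
      (((A.rot i).continuous.comp S.continuous_g).add continuous_const)
  exact closure_minimal (fun y hy => A.f_eq y i hy) hcl hx

lemma f_sub_f (A : Placement S) {i : ι} {x y : M} (hx : x ∈ closure (S.panelSet i))
    (hy : y ∈ closure (S.panelSet i)) : A.f y - A.f x = A.rot i (S.g y - S.g x) := by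
  rw [A.f_eq_of_mem_closure hx, A.f_eq_of_mem_closure hy, map_sub]
  abel

/-- Placements preserve the distances from `x` of the points near `x`, uniformly. -/
lemma exists_nhds_dist_eq (S : CreaseSurface M ι κ) (x : M) :
    ∃ N ∈ 𝓝 x, ∀ y ∈ N, ∀ A : Placement S, dist (A.f y) (A.f x) = dist (S.g y) (S.g x) := by
  obtain ⟨⟨N, hN, h⟩, -⟩ := S.exists_nhds x
  refine ⟨N, hN, fun y hy A => ?_⟩
  obtain ⟨i, hx, hy'⟩ := h y hy
  rw [dist_eq_norm, A.f_sub_f hx hy', LinearIsometryEquiv.norm_map, dist_eq_norm]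

/-- The neighbourhood of `exists_nhds_dist_eq` does not depend on the placement, so convergence at
its centre controls all its points. -/
lemma tendstoLocallyUniformly_of_tendsto {α : Type*} {l : Filter α} {B : α → Placement S}
    {A : Placement S} (h : ∀ x, Tendsto (fun t => (B t).f x) l (𝓝 (A.f x))) :
    TendstoLocallyUniformly (fun t => (B t).f) A.f l := by
  rw [Metric.tendstoLocallyUniformly_iff]
  intro ε hε x
  obtain ⟨N, hN, hd⟩ := exists_nhds_dist_eq S x
  have hg : {y | dist (S.g y) (S.g x) < ε / 3} ∈ 𝓝 x :=
    S.continuous_g.continuousAt.eventually (Metric.ball_mem_nhds _ (by positivity))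
  refine ⟨_, inter_mem hN hg, ?_⟩
  filter_upwards [(h x).eventually (Metric.ball_mem_nhds _ (show 0 < ε / 3 by positivity))]
    with t ht y hy
  have h1 := hd y hy.1 A
  have h2 := hd y hy.1 (B t)
  have h3 : dist (S.g y) (S.g x) < ε / 3 := hy.2
  have h4 : dist ((B t).f x) (A.f x) < ε / 3 := ht
  have h5 := dist_triangle4 (A.f y) (A.f x) ((B t).f x) ((B t).f y)
  rw [dist_comm (A.f x), dist_comm ((B t).f x) ((B t).f y)] at h5
  linarith

/-- The rotation of a panel depends continuously on the placement. -/
lemma tendsto_rot_of_tendsto {α : Type*} {l : Filter α} {B : α → Placement S}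
    {A : Placement S} (h : ∀ x, Tendsto (fun t => (B t).f x) l (𝓝 (A.f x))) (i : ι) (z : E3) :
    Tendsto (fun t => (B t).rot i z) l (𝓝 (A.rot i z)) := by
  refine tendsto_rotation_of_plane (fun t => (B t).det_rot i) (A.det_rot i) (S.norm_normal i)
    (fun v hv => ?_) z
  obtain ⟨x, hx⟩ := (S.panel_connected i).nonempty
  obtain ⟨N, hN, -, hsub, -, r, hr, hN'⟩ := S.panel_chart x i hx
  -- Shrink `v` until it fits into the chart disc; then `rot i v` is a multiple of a difference of
  -- two values of `f`. The `+ 1` covers `v = 0`.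
  obtain ⟨c, hc, hcr⟩ : ∃ c : ℝ, 0 < c ∧ c * ‖v‖ ≤ r := by
    refine ⟨r / (‖v‖ + 1), by positivity, ?_⟩
    rw [div_mul_eq_mul_div, div_le_iff₀ (by positivity)]
    nlinarith [norm_nonneg v]
  obtain ⟨y, hyN, hy⟩ : S.g x + c • v ∈ S.g '' N := by
    rw [hN']
    refine ⟨?_, ?_⟩
    · rw [dist_eq_norm, add_sub_cancel_left, norm_smul, Real.norm_of_nonneg hc.le]
      exact hcr
    · rw [add_sub_cancel_left, inner_smul_left, real_inner_comm, hv, mul_zero]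
  have key : ∀ A : Placement S, A.rot i v = c⁻¹ • (A.f y - A.f x) := by
    intro A
    rw [A.f_sub_f (subset_closure hx) (subset_closure (hsub hyN)), hy, add_sub_cancel_left,
      map_smul, smul_smul, inv_mul_cancel₀ hc.ne', one_smul]
  rw [key A]
  simp only [key]
  exact ((h y).sub (h x)).const_smul _

end Placement

/-! ### Geometry at a crease and the folding phase. -/

namespace CreasedPaper

variable {M ι κ : Type*} [TopologicalSpace M] (P : CreasedPaper M ι κ) (e : κ)

lemma norm_dir : ‖P.dir e‖ = 1 := P.ref_axis e ▸ (P.ref e).norm_axis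

lemma norm_leftVec : ‖P.leftVec e‖ = 1 := (P.ref_left e).2 ▸ (P.ref e).norm_a

lemma norm_rightVec : ‖P.rightVec e‖ = 1 := (P.ref_right e).2 ▸ (P.ref e).norm_b

lemma inner_dir_leftVec : inner ℝ (P.dir e) (P.leftVec e) = 0 := by
  rw [← P.ref_axis e, ← (P.ref_left e).2, (P.ref e).inner_a]

lemma inner_dir_rightVec : inner ℝ (P.dir e) (P.rightVec e) = 0 := by
  rw [← P.ref_axis e, ← (P.ref_right e).2, (P.ref e).inner_b]

lemma inner_leftVec_normal : inner ℝ (P.leftVec e) (P.normal (P.left e)) = 0 := by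
  rw [← (P.ref_left e).1, ← (P.ref_left e).2, (P.ref e).inner_a_normal]

lemma inner_dir_normal : inner ℝ (P.dir e) (P.normal (P.left e)) = 0 := by
  obtain ⟨F, -, hn, h1, -, hs, hu, hv, -⟩ := P.crease_chart _ e (P.ref_base e)
  have hpi := Real.pi_pos
  -- The crease ray is not inside the panel, so the diagonal ray is used: its direction is
  -- proportional to `dir + leftVec`, and `leftVec` is already known to be tangent.
  have h := F.inner_ray_normal (k := 0) (θ := Real.pi / 4) (by omega)
    (by rw [F.angle_zero, zero_add, h1]; constructor <;> linarith)
  rw [F.angle_zero, sub_zero, hs, hu, hv, inner_add_left, inner_smul_left, inner_smul_left,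
    P.inner_leftVec_normal, mul_zero, add_zero, Real.cos_pi_div_four] at h
  simpa using h

variable {P} (A : Placement P.toCreaseSurface)

lemma base_mem_closure_left : (P.ref e).base ∈ closure (P.panelSet (P.left e)) := by
  obtain ⟨F, -, hn, -, -, h0, -⟩ := P.crease_chart _ e (P.ref_base e)
  exact h0 ▸ F.center_mem_closure_panelSet (k := 0) (by omega)

lemma base_mem_closure_right : (P.ref e).base ∈ closure (P.panelSet (P.right e)) := by
  obtain ⟨F, -, hn, -, -, -, -, -, h1, -⟩ := P.crease_chart _ e (P.ref_base e)
  exact h1 ▸ F.center_mem_closure_panelSet (k := 1) (by omega)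

/-- The fan closes up, so a second crease point besides the base lies in both closed panels; both
rotations move their difference alike. -/
lemma rot_left_dir_eq : A.rot (P.left e) (P.dir e) = A.rot (P.right e) (P.dir e) := by
  obtain ⟨F, hcl, hn, h1, h2, hs0, hu0, -, hs1, -⟩ := P.crease_chart _ e (P.ref_base e)
  have hpi := Real.pi_pos
  have hr : F.radius ∈ Icc 0 F.radius := right_mem_Icc.2 F.radius_pos.le
  have hθ : (0 : ℝ) ∈ Icc (F.angle 0) (F.angle (0 + 1)) := by
    rw [F.angle_zero, zero_add, h1]; exact left_mem_Icc.2 hpi.le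
  have hl : F.toFun F.radius 0 ∈ closure (P.panelSet (P.left e)) :=
    hs0 ▸ F.mem_closure_panelSet (k := 0) (by omega) hr hθ
  have hr' : F.toFun F.radius 0 ∈ closure (P.panelSet (P.right e)) := by
    rw [F.wrap hcl _ hr, hn]
    exact hs1 ▸ F.mem_closure_panelSet (k := 1) (by omega) hr
      (right_mem_Icc.2 (F.angle_lt 1 (by omega)).le)
  have hg : P.g (F.toFun F.radius 0) - P.g (P.ref e).base = F.radius • P.dir e := by
    rw [F.isometric 0 (by omega) _ hr 0 hθ, F.angle_zero, hu0]
    simp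
  have e1 := A.f_sub_f (base_mem_closure_left e) hl
  have e2 := A.f_sub_f (base_mem_closure_right e) hr'
  rw [hg, map_smul] at e1 e2
  exact smul_right_injective _ F.radius_pos.ne' (e1.symm.trans e2)

lemma trans_right_eq : A.trans (P.right e) = A.rot (P.left e) (P.g (P.ref e).base) +
    A.trans (P.left e) - A.rot (P.right e) (P.g (P.ref e).base) := by
  rw [← A.f_eq_of_mem_closure (base_mem_closure_left e),
    A.f_eq_of_mem_closure (base_mem_closure_right e), add_sub_cancel_left]

lemma rot_rightVec_eq_planar : A.rot (P.right e) (P.rightVec e) =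
    inner ℝ (A.rot (P.right e) (P.rightVec e)) (A.rot (P.left e) (P.leftVec e)) •
        A.rot (P.left e) (P.leftVec e) +
      inner ℝ (A.rot (P.right e) (P.rightVec e)) (A.rot (P.left e) (P.normal (P.left e))) •
        A.rot (P.left e) (P.normal (P.left e)) := by
  refine eq_planar_expansion (d := A.rot (P.left e) (P.dir e)) ?_ ?_ ?_ ?_ ?_ ?_ ?_
  · rw [LinearIsometryEquiv.norm_map, P.norm_dir]
  · rw [LinearIsometryEquiv.norm_map, P.norm_leftVec]
  · rw [LinearIsometryEquiv.norm_map, P.norm_normal]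
  · rw [LinearIsometryEquiv.inner_map_map, P.inner_dir_leftVec]
  · rw [LinearIsometryEquiv.inner_map_map, P.inner_dir_normal]
  · rw [LinearIsometryEquiv.inner_map_map, P.inner_leftVec_normal]
  · rw [rot_left_dir_eq, LinearIsometryEquiv.inner_map_map, P.inner_dir_rightVec]

/-- The complex number of modulus one whose argument is the folding angle. -/
noncomputable def foldingPhase : ℂ :=
  ⟨- inner ℝ (A.rot (P.right e) (P.rightVec e)) (A.rot (P.left e) (P.leftVec e)),
    - inner ℝ (A.rot (P.right e) (P.rightVec e)) (A.rot (P.left e) (P.normal (P.left e)))⟩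

lemma rot_rightVec_eq_foldingPhase : A.rot (P.right e) (P.rightVec e) =
    - (foldingPhase e A).re • A.rot (P.left e) (P.leftVec e) -
      (foldingPhase e A).im • A.rot (P.left e) (P.normal (P.left e)) := by
  conv_lhs => rw [rot_rightVec_eq_planar e A]
  simp only [foldingPhase, neg_neg, neg_smul, sub_neg_eq_add]

lemma norm_foldingPhase : ‖foldingPhase e A‖ = 1 := by
  have h := congrArg (fun w => ‖w‖ ^ 2) (rot_rightVec_eq_foldingPhase e A)
  simp only [neg_smul] at h
  rw [LinearIsometryEquiv.norm_map, P.norm_rightVec, norm_sub_sq_real, norm_neg, norm_smul,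
    norm_smul, LinearIsometryEquiv.norm_map, LinearIsometryEquiv.norm_map, P.norm_normal,
    P.norm_leftVec, inner_neg_left, inner_smul_left, inner_smul_right,
    LinearIsometryEquiv.inner_map_map, P.inner_leftVec_normal] at h
  simp only [mul_one, mul_zero, neg_zero, sub_zero, one_pow, Real.norm_eq_abs, sq_abs] at h
  rw [← sq_eq_sq₀ (norm_nonneg _) zero_le_one, ← Complex.normSq_eq_norm_sq, Complex.normSq_apply]
  linarith

lemma foldingPhase_eq_neg_one_iff : foldingPhase e A = -1 ↔
    A.rot (P.right e) (P.rightVec e) = A.rot (P.left e) (P.leftVec e) := by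
  constructor
  · intro h
    rw [rot_rightVec_eq_foldingPhase, h]
    simp
  · intro h
    unfold foldingPhase
    rw [h, real_inner_self_eq_norm_sq, LinearIsometryEquiv.norm_map, P.norm_leftVec,
      LinearIsometryEquiv.inner_map_map, P.inner_leftVec_normal]
    apply Complex.ext <;> simp

open Classical in
lemma bend_ref_eq (lam : M → M → ℝ) : A.bend lam (P.ref e) =
    if foldingPhase e A = -1 then
      if lam ((P.ref e).path (-(P.ref e).radius)) ((P.ref e).path (P.ref e).radius) = 1 then
        -Real.pi else Real.pi
    else (foldingPhase e A).arg := by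
  simp only [foldingPhase_eq_neg_one_iff]
  simp only [Placement.bend, foldingPhase, (P.ref_left e).1, (P.ref_left e).2, (P.ref_right e).1,
    (P.ref_right e).2]

/-- The choice between `π` and `-π` does not affect the cosine, so the phase is a continuous
function of the angle alone. -/
lemma cos_bend_ref (lam : M → M → ℝ) :
    Real.cos (A.bend lam (P.ref e)) = (foldingPhase e A).re := by
  rw [bend_ref_eq]
  have hne : foldingPhase e A ≠ 0 := by
    rw [← norm_ne_zero_iff, norm_foldingPhase]; exact one_ne_zero
  split_ifs with h1 h2
  · simp [h1]
  · simp [h1]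
  · rw [Complex.cos_arg hne, norm_foldingPhase, div_one]

lemma sin_bend_ref (lam : M → M → ℝ) :
    Real.sin (A.bend lam (P.ref e)) = (foldingPhase e A).im := by
  rw [bend_ref_eq]
  split_ifs with h1 h2
  · simp [h1]
  · simp [h1]
  · rw [Complex.sin_arg, norm_foldingPhase, div_one]

end CreasedPaper

/-! ### Convergence of placements and of phases. -/

section Continuity

variable {M ι κ : Type*} [TopologicalSpace M] {P : CreasedPaper M ι κ}
variable {α : Type*} {l : Filter α} {B : α → Placement P.toCreaseSurface}
  {A : Placement P.toCreaseSurface}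

/-- The crease-dependent sign that compares the normal of the left panel with `dir × leftVec`. -/
lemma CreasedPaper.exists_normal_eq (P : CreasedPaper M ι κ) (e : κ) :
    ∃ σ : ℝ, σ * σ = 1 ∧ P.normal (P.left e) = σ • cross (P.dir e) (P.leftVec e) := by
  have h := eq_frame_expansion (P.norm_dir e) (P.norm_leftVec e) (P.inner_dir_leftVec e)
    (P.normal (P.left e))
  rw [P.inner_dir_normal, P.inner_leftVec_normal, zero_smul, zero_smul, zero_add, zero_add] at h
  refine ⟨_, ?_, h⟩
  have h1 := real_inner_self_eq_norm_sq (P.normal (P.left e))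
  nth_rewrite 1 [h] at h1
  rw [inner_smul_left, P.norm_normal] at h1
  simpa using h1

/-- Inverts `rot_rightVec_eq_foldingPhase`, to cross a crease from right to left. Multiplying that
formula by `dir ×` gives a second equation in the plane perpendicular to the crease; the system is
orthogonal because the phase has modulus one and `σ² = 1`. -/
lemma CreasedPaper.rot_leftVec_eq (A : Placement P.toCreaseSurface) {e : κ} {σ : ℝ}
    (hσ : σ * σ = 1) (hn : P.normal (P.left e) = σ • cross (P.dir e) (P.leftVec e)) :
    A.rot (P.left e) (P.leftVec e) = (-(foldingPhase e A).re) • A.rot (P.right e) (P.rightVec e) +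
      (σ * (foldingPhase e A).im) •
        cross (A.rot (P.right e) (P.dir e)) (A.rot (P.right e) (P.rightVec e)) := by
  have hz : (foldingPhase e A).re * (foldingPhase e A).re +
      (foldingPhase e A).im * (foldingPhase e A).im = 1 := by
    rw [← Complex.normSq_apply, Complex.normSq_eq_norm_sq, norm_foldingPhase, one_pow]
  have hb := rot_rightVec_eq_foldingPhase e A
  rw [hn, map_smul, map_cross _ (A.det_rot _), smul_smul, neg_smul, ← neg_smul, sub_eq_add_neg,
    ← neg_smul] at hb
  have hc := congrArg (cross (A.rot (P.left e) (P.dir e))) hb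
  rw [cross_add_smul, cross_cross_right, LinearIsometryEquiv.inner_map_map, P.inner_dir_leftVec,
    LinearIsometryEquiv.inner_map_map, real_inner_self_eq_norm_sq, P.norm_dir] at hc
  rw [← rot_left_dir_eq, hc, hb]
  generalize (foldingPhase e A).re = x at *
  generalize (foldingPhase e A).im = y at *
  match_scalars
  · linear_combination -(1 : ℝ) * hz - y * y * hσ
  · ring
  · ring

/-- The placement depends continuously on the folding angles. -/
lemma CreasedPaper.tendsto_of_tendsto_foldingPhase {i₀ : ι}
    (h₀ : (∀ v, Tendsto (fun t => (B t).rot i₀ v) l (𝓝 (A.rot i₀ v))) ∧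
      Tendsto (fun t => (B t).trans i₀) l (𝓝 (A.trans i₀)))
    (h : ∀ e, Tendsto (fun t => foldingPhase e (B t)) l (𝓝 (foldingPhase e A))) (i : ι) :
    (∀ v, Tendsto (fun t => (B t).rot i v) l (𝓝 (A.rot i v))) ∧
      Tendsto (fun t => (B t).trans i) l (𝓝 (A.trans i)) := by
  -- It suffices that convergence passes across every crease in both directions.
  refine (P.toCreaseSurface.linked_all i₀ i
    (fun i => (∀ v, Tendsto (fun t => (B t).rot i v) l (𝓝 (A.rot i v))) ∧
      Tendsto (fun t => (B t).trans i) l (𝓝 (A.trans i))) fun e => ?_).1 h₀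
  have hre : Tendsto (fun t => (foldingPhase e (B t)).re) l (𝓝 (foldingPhase e A).re) :=
    (Complex.continuous_re.tendsto _).comp (h e)
  have him : Tendsto (fun t => (foldingPhase e (B t)).im) l (𝓝 (foldingPhase e A).im) :=
    (Complex.continuous_im.tendsto _).comp (h e)
  constructor
  · rintro ⟨hrot, htrans⟩
    have key : ∀ v, Tendsto (fun t => (B t).rot (P.right e) v) l (𝓝 (A.rot (P.right e) v)) := by
      refine tendsto_rotation_of_orthonormal (fun t => (B t).det_rot _) (A.det_rot _)
        (P.norm_dir e) (P.norm_rightVec e) (P.inner_dir_rightVec e) ?_ ?_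
      · simp only [← rot_left_dir_eq]
        exact hrot _
      · simp only [rot_rightVec_eq_foldingPhase]
        exact (hre.neg.smul (hrot _)).sub (him.smul (hrot _))
    refine ⟨key, ?_⟩
    simp only [trans_right_eq]
    exact ((hrot _).add htrans).sub (key _)
  · rintro ⟨hrot, htrans⟩
    obtain ⟨σ, hσ, hn⟩ := P.exists_normal_eq e
    have key : ∀ v, Tendsto (fun t => (B t).rot (P.left e) v) l (𝓝 (A.rot (P.left e) v)) := by
      refine tendsto_rotation_of_orthonormal (fun t => (B t).det_rot _) (A.det_rot _)
        (P.norm_dir e) (P.norm_leftVec e) (P.inner_dir_leftVec e) ?_ ?_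
      · simp only [rot_left_dir_eq]
        exact hrot _
      · simp only [rot_leftVec_eq _ hσ hn]
        have hcross := (continuous_cross.tendsto _).comp
          ((hrot (P.dir e)).prodMk_nhds (hrot (P.rightVec e)))
        exact (hre.neg.smul (hrot _)).add ((him.const_mul σ).smul hcross)
    refine ⟨key, ?_⟩
    have htl : ∀ A : Placement P.toCreaseSurface, A.trans (P.left e) = A.trans (P.right e) +
        A.rot (P.right e) (P.g (P.ref e).base) - A.rot (P.left e) (P.g (P.ref e).base) := by
      intro A
      rw [trans_right_eq]
      abel
    simp only [htl]
    exact (htrans.add (hrot _)).sub (key _)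

lemma CreasedPaper.tendsto_foldingPhase (e : κ)
    (h : ∀ x, Tendsto (fun t => (B t).f x) l (𝓝 (A.f x))) :
    Tendsto (fun t => foldingPhase e (B t)) l (𝓝 (foldingPhase e A)) := by
  have hr := fun i v => Placement.tendsto_rot_of_tendsto h i v
  have hc : Continuous fun p : ℝ × ℝ => (⟨-p.1, -p.2⟩ : ℂ) :=
    Complex.equivRealProdCLM.symm.continuous.comp (continuous_fst.neg.prodMk continuous_snd.neg)
  have h1 := (hr (P.right e) (P.rightVec e)).inner (𝕜 := ℝ) (hr (P.left e) (P.leftVec e))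
  have h2 := (hr (P.right e) (P.rightVec e)).inner (𝕜 := ℝ) (hr (P.left e) (P.normal (P.left e)))
  exact (hc.tendsto _).comp (h1.prodMk_nhds h2)

end Continuity

/-! ### Folding angles and rigidly folded states. -/

section States

variable {M ι κ : Type*} [TopologicalSpace M] {P : CreasedPaper M ι κ} {i₀ : ι}
variable {α : Type*} {l : Filter α} {S : α → RigidlyFoldedState P i₀}
  {s : RigidlyFoldedState P i₀}

lemma RigidlyFoldedState.foldingPhase_eq (s : RigidlyFoldedState P i₀) (e : κ) :
    CreasedPaper.foldingPhase e s.toPlacement =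
      Real.cos (s.foldingAngle e) + Real.sin (s.foldingAngle e) * Complex.I := by
  rw [foldingAngle, CreasedPaper.cos_bend_ref, CreasedPaper.sin_bend_ref, Complex.re_add_im]

lemma tendsto_of_tendsto_foldingAngle
    (h : ∀ e, Tendsto (fun t => (S t).foldingAngle e) l (𝓝 (s.foldingAngle e))) (i : ι) :
    (∀ v, Tendsto (fun t => (S t).rot i v) l (𝓝 (s.rot i v))) ∧
      Tendsto (fun t => (S t).trans i) l (𝓝 (s.trans i)) := by
  refine CreasedPaper.tendsto_of_tendsto_foldingPhase (i₀ := i₀)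
    (B := fun t => (S t).toPlacement) ⟨fun v => ?_, ?_⟩ (fun e => ?_) i
  · simp only [RigidlyFoldedState.rot_base]
    exact tendsto_const_nhds
  · simp only [RigidlyFoldedState.trans_base]
    exact tendsto_const_nhds
  · simp only [RigidlyFoldedState.foldingPhase_eq]
    have hc : Continuous fun x : ℝ => (Real.cos x + Real.sin x * Complex.I : ℂ) := by fun_prop
    exact (hc.tendsto _).comp (h e)

lemma tendsto_f_of_tendsto_foldingAngle
    (h : ∀ e, Tendsto (fun t => (S t).foldingAngle e) l (𝓝 (s.foldingAngle e))) (x : M) :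
    Tendsto (fun t => (S t).f x) l (𝓝 (s.f x)) := by
  obtain ⟨⟨N, hN, hi⟩, -⟩ := P.toCreaseSurface.exists_nhds x
  obtain ⟨i, hx, -⟩ := hi x (mem_of_mem_nhds hN)
  obtain ⟨hr, ht⟩ := tendsto_of_tendsto_foldingAngle h i
  rw [s.f_eq_of_mem_closure hx]
  simp only [(S _).f_eq_of_mem_closure hx]
  exact (hr _).add ht

/-- A rigidly folded state is determined by its folding angles and its order function. -/
lemma RigidlyFoldedState.eq_of_foldingAngle_eq {s s' : RigidlyFoldedState P i₀}
    (h : s.foldingAngle = s'.foldingAngle) (ho : s.order = s'.order) : s = s' := by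
  -- Uniqueness from continuity: the constant family `s` converges to `s'`, and limits are unique.
  have h' : ∀ e, Tendsto (fun _ : Unit => s.foldingAngle e) ⊤ (𝓝 (s'.foldingAngle e)) :=
    fun e => h ▸ tendsto_const_nhds
  have hf : s.f = s'.f := funext fun x =>
    tendsto_nhds_unique tendsto_const_nhds (tendsto_f_of_tendsto_foldingAngle h' x)
  have hr : s.rot = s'.rot := funext fun i => LinearIsometryEquiv.ext fun v =>
    tendsto_nhds_unique tendsto_const_nhds ((tendsto_of_tendsto_foldingAngle h' i).1 v)
  have ht : s.trans = s'.trans := funext fun i =>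
    tendsto_nhds_unique tendsto_const_nhds (tendsto_of_tendsto_foldingAngle h' i).2
  obtain ⟨⟨f, rot, trans, _, _, _, _, _⟩, order, _, _, _⟩ := s
  obtain ⟨⟨f', rot', trans', _, _, _, _, _⟩, order', _, _, _⟩ := s'
  subst hf hr ht ho
  rfl

lemma configurationMap_spec (c : ConfigurationSpace P i₀) :
    ((configurationMap c).foldingAngle, (configurationMap c).order) = c.1 :=
  c.2.choose_spec

lemma configurationMap_configuration (s : RigidlyFoldedState P i₀) :
    configurationMap s.configuration = s :=
  have h := configurationMap_spec s.configuration
  RigidlyFoldedState.eq_of_foldingAngle_eq (congrArg Prod.fst h) (congrArg Prod.snd h)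

lemma Placement.f_ref_sub (A : Placement P.toCreaseSurface) (e : κ) :
    A.f ((P.ref e).path (-(P.ref e).radius)) - A.f ((P.ref e).path (P.ref e).radius) =
      (P.ref e).radius • (A.rot (P.right e) (P.rightVec e) - A.rot (P.left e) (P.leftVec e)) := by
  have hr : (P.ref e).radius ∈ Ioc 0 (P.ref e).radius := right_mem_Ioc.2 (P.ref e).radius_pos
  obtain ⟨hp, hpg⟩ := (P.ref e).pos _ hr
  obtain ⟨hn, hng⟩ := (P.ref e).neg _ hr
  rw [(P.ref_left e).1] at hp
  rw [(P.ref_left e).2] at hpg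
  rw [(P.ref_right e).1] at hn
  rw [(P.ref_right e).2] at hng
  have h1 := A.f_sub_f (CreasedPaper.base_mem_closure_left e) (subset_closure hp)
  have h2 := A.f_sub_f (CreasedPaper.base_mem_closure_right e) (subset_closure hn)
  rw [hpg, add_sub_cancel_left, map_smul] at h1
  rw [hng, add_sub_cancel_left, map_smul] at h2
  rw [smul_sub, ← h1, ← h2]
  abel

lemma Placement.contact_ref_of_foldingPhase_eq (A : Placement P.toCreaseSurface) {e : κ}
    (h : CreasedPaper.foldingPhase e A = -1) :
    A.Contact ((P.ref e).path (-(P.ref e).radius)) ((P.ref e).path (P.ref e).radius) := by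
  have hr0 := (P.ref e).radius_pos
  have hr : (P.ref e).radius ∈ Ioc 0 (P.ref e).radius := right_mem_Ioc.2 hr0
  refine ⟨fun heq => ?_, ⟨_, ((P.ref e).neg _ hr).1⟩, ⟨_, ((P.ref e).pos _ hr).1⟩, ?_⟩
  · have := (P.ref e).injOn (left_mem_Icc.2 (by linarith)) (right_mem_Icc.2 (by linarith)) heq
    linarith
  · rw [← sub_eq_zero, A.f_ref_sub, (CreasedPaper.foldingPhase_eq_neg_one_iff e A).1 h, sub_self,
      smul_zero]

/-- Turns the side condition in `OrderTendsto` into a sign condition on the imaginary part of the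
phase. -/
lemma Placement.inner_f_ref_sub_normal (A : Placement P.toCreaseSurface) (e : κ) :
    inner ℝ (A.f ((P.ref e).path (-(P.ref e).radius)) - A.f ((P.ref e).path (P.ref e).radius))
      (A.normal ((P.ref e).path (P.ref e).radius)) =
      -((P.ref e).radius * (CreasedPaper.foldingPhase e A).im) := by
  have hn : A.normal ((P.ref e).path (P.ref e).radius) =
      A.rot (P.left e) (P.normal (P.left e)) := by
    have h := ((P.ref e).pos _ (right_mem_Ioc.2 (P.ref e).radius_pos)).1
    rw [(P.ref_left e).1] at h
    simp only [Placement.normal, h]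
  rw [A.f_ref_sub, hn, inner_smul_left, inner_sub_left, LinearIsometryEquiv.inner_map_map (A.rot _),
    P.inner_leftVec_normal, sub_zero]
  simp [CreasedPaper.foldingPhase]

lemma tendsto_foldingAngle (hf : ∀ x, Tendsto (fun t => (S t).f x) l (𝓝 (s.f x)))
    (ho : OrderTendsto l S s) (e : κ) :
    Tendsto (fun t => (S t).foldingAngle e) l (𝓝 (s.foldingAngle e)) := by
  have hz := CreasedPaper.tendsto_foldingPhase (B := fun t => (S t).toPlacement) e hf
  set z := CreasedPaper.foldingPhase e s.toPlacement with hzdef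
  have hang : ∀ s : RigidlyFoldedState P i₀, CreasedPaper.foldingPhase e s.toPlacement ≠ -1 →
      s.foldingAngle e = (CreasedPaper.foldingPhase e s.toPlacement).arg := fun s h => by
    rw [RigidlyFoldedState.foldingAngle, CreasedPaper.bend_ref_eq, if_neg h]
  have hreal : ∀ A : Placement P.toCreaseSurface, (CreasedPaper.foldingPhase e A).re ≤ 0 →
      (CreasedPaper.foldingPhase e A).im = 0 → CreasedPaper.foldingPhase e A = -1 := by
    intro A hre him
    have h := CreasedPaper.norm_foldingPhase e A
    rw [← Complex.re_add_im (CreasedPaper.foldingPhase e A), him] at h ⊢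
    simp only [Complex.ofReal_zero, zero_mul, add_zero, Complex.norm_real, Real.norm_eq_abs,
      abs_of_nonpos hre] at h ⊢
    rw [← neg_eq_iff_eq_neg.2 h.symm]
    simp
  by_cases hz1 : z = -1
  · rw [hz1] at hz
    have hc := s.toPlacement.contact_ref_of_foldingPhase_eq hz1
    have hr0 := (P.ref e).radius_pos
    obtain ⟨U, hU, V, hV, hev⟩ := ho _ _ hc
    have hre : ∀ᶠ t in l, (CreasedPaper.foldingPhase e (S t).toPlacement).re < 0 :=
      ((Complex.continuous_re.tendsto _).comp hz).eventually (gt_mem_nhds (by simp))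
    have hs := CreasedPaper.bend_ref_eq e s.toPlacement s.order
    rw [if_pos hz1] at hs
    rcases s.isOrder.values _ _ hc with h1 | h1
    · rw [RigidlyFoldedState.foldingAngle, hs, if_pos h1]
      -- `Complex.arg` is `π` at `-1`, but here the limit angle is `-π`; the patched function is
      -- continuous at `-1`.
      have hlim : Tendsto (fun w : ℂ => if w.im < 0 then w.arg else -Real.pi) (𝓝 (-1))
          (𝓝 (-Real.pi)) :=
        Tendsto.if (Complex.tendsto_arg_nhdsWithin_im_neg_of_re_neg_of_im_zero (by simp) (by simp))
          tendsto_const_nhds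
      refine (hlim.comp hz).congr' ?_
      filter_upwards [hev, hre] with t ht hret
      obtain ⟨hord, hside⟩ := ht _ (mem_of_mem_nhds hU) _ (mem_of_mem_nhds hV)
      rw [Placement.inner_f_ref_sub_normal, h1] at hside
      have him : (CreasedPaper.foldingPhase e (S t).toPlacement).im ≤ 0 := by
        by_contra hpos
        nlinarith [mul_pos hr0 (not_le.1 hpos)]
      by_cases ht1 : CreasedPaper.foldingPhase e (S t).toPlacement = -1
      · have h2 := hord ((S t).toPlacement.contact_ref_of_foldingPhase_eq ht1)
        simp only [Function.comp_apply]
        rw [RigidlyFoldedState.foldingAngle, CreasedPaper.bend_ref_eq, if_pos ht1,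
          if_pos (h2.trans h1), ht1]
        simp
      -- A real phase with negative real part would be `-1`.
      · have hlt := him.lt_of_ne fun h => ht1 (hreal _ hret.le h)
        simp only [Function.comp_apply]
        rw [hang _ ht1, if_pos hlt]
    · have hne : ¬ ((-1 : ℝ) = 1) := by norm_num
      rw [RigidlyFoldedState.foldingAngle, hs, if_neg (h1 ▸ hne)]
      -- No patch is needed here: from the closed upper half-plane `Complex.arg` is continuous at
      -- `-1`, with value `π`.
      have hev' : ∀ᶠ t in l, 0 ≤ (CreasedPaper.foldingPhase e (S t).toPlacement).im ∧
          (CreasedPaper.foldingPhase e (S t).toPlacement).arg = (S t).foldingAngle e := by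
        filter_upwards [hev] with t ht
        obtain ⟨hord, hside⟩ := ht _ (mem_of_mem_nhds hU) _ (mem_of_mem_nhds hV)
        rw [Placement.inner_f_ref_sub_normal, h1] at hside
        refine ⟨by by_contra hneg; nlinarith [mul_pos hr0 (neg_pos.2 (not_le.1 hneg))], ?_⟩
        by_cases ht1 : CreasedPaper.foldingPhase e (S t).toPlacement = -1
        · have h2 := (hord ((S t).toPlacement.contact_ref_of_foldingPhase_eq ht1)).trans h1
          rw [RigidlyFoldedState.foldingAngle, CreasedPaper.bend_ref_eq, if_pos ht1,
            if_neg (h2 ▸ hne), ht1, Complex.arg_neg_one]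
        · exact (hang _ ht1).symm
      exact ((Complex.tendsto_arg_nhdsWithin_im_nonneg_of_re_neg_of_im_zero (by simp)
        (by simp)).comp (tendsto_nhdsWithin_iff.2 ⟨hz, hev'.mono fun _ h => h.1⟩)).congr'
          (hev'.mono fun _ h => h.2)
  · have hslit : z ∈ Complex.slitPlane := by
      rw [Complex.mem_slitPlane_iff]
      by_contra! hcon
      exact hz1 (hreal _ hcon.1 hcon.2)
    rw [hang s hz1]
    refine ((Complex.continuousAt_arg hslit).tendsto.comp hz).congr' ?_
    filter_upwards [hz.eventually_ne hz1] with t ht using (hang _ ht).symm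

end States

end RigidOrigami

/-! ### Transport of paths by the configuration map. -/

theorem mainTheorem1 {M ι κ : Type*} [TopologicalSpace M] (P : RigidOrigami.CreasedPaper M ι κ)
    (i₀ : ι) (s₁ s₂ : RigidOrigami.RigidlyFoldedState P i₀) :
    (CompactSpace M →
      (RigidOrigami.RigidFoldable s₁ s₂ ↔
        RigidOrigami.ZeroConnected s₁.configuration s₂.configuration)) ∧
    (RigidOrigami.LocallyRigidFoldable s₁ s₂ ↔
      RigidOrigami.ZeroConnected s₁.configuration s₂.configuration) := by
  have main : RigidOrigami.LocallyRigidFoldable s₁ s₂ ↔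
      RigidOrigami.ZeroConnected s₁.configuration s₂.configuration := by
    constructor
    · rintro ⟨γ, h0, h1, h⟩
      refine ⟨fun t => (γ t).configuration, congrArg _ h0, congrArg _ h1, fun t => ⟨?_, ?_⟩⟩
      · exact tendsto_pi_nhds.2 (RigidOrigami.tendsto_foldingAngle
          (fun x => (h t).1.tendstoLocallyUniformlyOn.tendsto_at (mem_univ x)) (h t).2)
      · simp only [RigidOrigami.configurationMap_configuration]
        exact (h t).2
    · rintro ⟨L, h0, h1, h⟩
      refine ⟨fun t => RigidOrigami.configurationMap (L t), ?_, ?_, fun t => ⟨?_, (h t).2⟩⟩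
      · exact (congrArg _ h0).trans (RigidOrigami.configurationMap_configuration s₁)
      · exact (congrArg _ h1).trans (RigidOrigami.configurationMap_configuration s₂)
      · refine RigidOrigami.Placement.tendstoLocallyUniformly_of_tendsto
          (B := fun t => (RigidOrigami.configurationMap (L t)).toPlacement)
          (RigidOrigami.tendsto_f_of_tendsto_foldingAngle fun e => ?_)
        have hL := tendsto_pi_nhds.1 (h t).1 e
        simpa only [← RigidOrigami.configurationMap_spec] using hL
  refine ⟨fun _ => ?_, main⟩
  rw [← main]
  simp only [RigidOrigami.RigidFoldable, RigidOrigami.LocallyRigidFoldable,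
    tendstoLocallyUniformly_iff_tendstoUniformly_of_compactSpace]
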